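/- Let $q$ be a power of an odd prime and regard $\mathrm{SL}_2(q)$ as a subgroup of $\mathrm{SL}_2(q^2)$ through an inclusion of fields $\mathbb{F}_q\subseteq\mathbb{F}_{q^2}$. Let $N=N_{\mathrm{SL}_2(q^2)}(\mathrm{SL}_2(q))$, and let $W=N\wr S_3=N_0\rtimes X$ be the wreath product with base group $N_0=N\times N\times N$ and with $X=S_3$ permuting the three coordinates. Let $O^2(N_0)$ be the smallest normal subgroup of $N_0$ whose index is a power of $2$ and put $$\hat K=O^2(N_0)\,X\,C_{N_0}(X)\le W,\qquad K=\hat K/Z(\hat K).$$ Let $S$ be a Sylow $2$-subgroup of $K$; this is the $2$-group over which the Benson–Solomon fusion system $\mathrm{Sol}(q)$ is defined. Then the sectional rank of $S$, that is, the largest $r$ such that there are subgroups $M\trianglelefteq P\le S$ with $P/M\cong (C_2)^r$, is equal to $6$. -/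

import Mathlib

open scoped MatrixGroups

namespace BensonSolomon

/-- `G` has a section `P / M` (with `M ⊴ P ≤ G`) which is an elementary abelian `p`-group
of rank `r`. -/
def HasElementaryAbelianSection (p : ℕ) (G : Type*) [Group G] (r : ℕ) : Prop :=
  ∃ (P : Subgroup G) (M : Subgroup P) (_ : M.Normal),
    Nonempty (P ⧸ M ≃* Multiplicative (Fin r → ZMod p))

/-- `s` is the sectional `p`-rank of `G`: the largest rank of an elementary abelian `p`-section
of `G`. -/
def IsSectionalRank (p : ℕ) (G : Type*) [Group G] (s : ℕ) : Prop :=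
  IsGreatest {r : ℕ | HasElementaryAbelianSection p G r} s

/-- `O^p(G)`, for a finite group `G`: the smallest normal subgroup of `G` whose index is a power
of `p`. -/
def pResidual (p : ℕ) (G : Type*) [Group G] : Subgroup G :=
  sInf {M : Subgroup G | M.Normal ∧ ∃ k : ℕ, M.index = p ^ k}

section Construction

variable (F E : Type*) [Field F] [Field E] [Algebra F E]

/-- `SL₂(F)`, as a subgroup of `SL₂(E)` via the inclusion of fields `F → E`. -/
def SL2sub : Subgroup SL(2, E) :=
  (Matrix.SpecialLinearGroup.map (n := Fin 2) (algebraMap F E)).range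

/-- `N = N_{SL₂(E)}(SL₂(F))`. -/
def N : Subgroup SL(2, E) := Subgroup.normalizer (SL2sub F E : Set SL(2, E))

/-- The wreath product `W = N ≀ S₃ = (N × N × N) ⋊ S₃`, where `S₃` permutes the three
coordinates. -/
abbrev W : Type _ := (Fin 3 → N F E) ⋊[mulAutArrow] Equiv.Perm (Fin 3)

/-- The base subgroup `N₀ = N₁ × N₂ × N₃` of `W`. -/
def base : Subgroup (W F E) := (SemidirectProduct.inl : (Fin 3 → N F E) →* W F E).range

/-- The acting subgroup `X ≅ S₃` of `W`. -/
def X : Subgroup (W F E) := (SemidirectProduct.inr : Equiv.Perm (Fin 3) →* W F E).range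

/-- `O²(N₀)`, as a subgroup of `W`. -/
def baseResidual : Subgroup (W F E) := (pResidual 2 (base F E)).map (base F E).subtype

/-- `K̂ = O²(N₀) X C_{N₀}(X)`. -/
def Khat : Subgroup (W F E) :=
  baseResidual F E ⊔ X F E ⊔ (base F E ⊓ Subgroup.centralizer (X F E : Set (W F E)))

/-- `K = K̂ / Z(K̂)`. -/
abbrev K : Type _ := Khat F E ⧸ Subgroup.center (Khat F E)

end Construction

end BensonSolomon

/-! Upper bound: `S` is a quotient of a 2-subgroup of `N ≀ S₃`, whose Sylow 2-subgroups are `R ≀ C₂`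
acting on three coordinates, with `R` a Sylow 2-subgroup of `N`. As a 2-subgroup of `SL₂(E)`, `R`
has at most one involution and an abelian normal subgroup `A` of index at most 2. The abelian group
`A³` contributes rank at most 3 (`SectionBound.of_comm`). So does `(R/A) ≀ C₂`, which has order 2,
or order 16 and is nonabelian (`SwapWreath.sectionBound_eight`). Ranks add along extensions
(`SectionBound.of_ker`).

Lower bound: `SL₂(F)` contains `Q₈`, and `SL₂(F)³` lies in `O²(N₀)`. An element of `Q₈³` that
becomes central in `K̂` is already central in `Q₈³`, so the image of `Q₈³` in `K` maps onto
`(Q₈/Z(Q₈))³`, of rank 6. -/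

namespace BensonSolomon

/-! ### Upper bounds for elementary abelian 2-sections -/

section SectionBound

/-- Every section `P / M` of `G` which is an elementary abelian `2`-group has order at most `c`. -/
def SectionBound (G : Type*) [Group G] (c : ℕ) : Prop :=
  ∀ P M : Subgroup G, M ≤ P → (∀ x ∈ P, ∀ y ∈ P, x * y * x⁻¹ * y⁻¹ ∈ M) →
    (∀ x ∈ P, x * x ∈ M) → M.relIndex P ≤ c

variable {G H : Type*} [Group G] [Group H]

theorem SectionBound.of_injective {c : ℕ} (h : SectionBound H c) (f : G →* H)
    (hf : Function.Injective f) : SectionBound G c := by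
  intro P M hMP hc hs
  rw [← Subgroup.relIndex_map_map_of_injective M P hf]
  refine h _ _ (Subgroup.map_mono hMP) ?_ ?_
  · rintro _ ⟨x, hx, rfl⟩ _ ⟨y, hy, rfl⟩
    exact ⟨_, hc x hx y hy, by simp⟩
  · rintro _ ⟨x, hx, rfl⟩
    exact ⟨_, hs x hx, by simp⟩

theorem SectionBound.of_surjective {c : ℕ} (h : SectionBound G c) (f : G →* H)
    (hf : Function.Surjective f) : SectionBound H c := by
  intro P M hMP hc hs
  have := h (P.comap f) (M.comap f) (Subgroup.comap_mono hMP)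
    (fun x hx y hy => by simpa using hc _ hx _ hy) (fun x hx => by simpa using hs _ hx)
  rwa [Subgroup.relIndex_comap, Subgroup.map_comap_eq_self_of_surjective hf] at this

theorem index_le_relIndex_ker_mul_index_map [Finite G] (M : Subgroup G) [M.Normal] (f : G →* H) :
    M.index = M.relIndex f.ker * (M.map f).relIndex f.range := by
  rw [← Subgroup.relIndex_mul_index (le_sup_right : M ≤ f.ker ⊔ M), Subgroup.relIndex_sup_right,
    MonoidHom.range_eq_map, Subgroup.relIndex_map_map, top_sup_eq, Subgroup.relIndex_top_right,
    sup_comm]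

/-- Intersecting `P` and `M` with the kernel gives one section, and their images in `H` give
another; the order of `P/M` is the product of the two orders. -/
theorem SectionBound.of_ker [Finite G] {c d : ℕ} (f : G →* H) (hk : SectionBound f.ker c)
    (hH : SectionBound H d) : SectionBound G (c * d) := by
  intro P M hMP hc hs
  have hN : (M.subgroupOf P).Normal := by
    refine ⟨fun m hm g => ?_⟩
    have h1 := hc g g.2 m m.2
    have h2 := M.mul_mem h1 hm
    simpa [Subgroup.mem_subgroupOf] using h2
  rw [Subgroup.relIndex, index_le_relIndex_ker_mul_index_map (M.subgroupOf P) (f.comp P.subtype)]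
  refine Nat.mul_le_mul ?_ ?_
  · have h1 := hk (P.subgroupOf f.ker) (M.subgroupOf f.ker) (Subgroup.comap_mono hMP)
      (fun x hx y hy => hc _ hx _ hy) (fun x hx => hs _ hx)
    have h2 : (f.comp P.subtype).ker = f.ker.subgroupOf P := rfl
    rw [h2]
    rw [Subgroup.subgroupOf, Subgroup.relIndex_comap] at h1 ⊢
    rw [Subgroup.subgroupOf_map_subtype] at h1 ⊢
    rwa [inf_comm]
  · refine hH _ _ (Subgroup.map_le_range _ _) ?_ ?_
    · rintro _ ⟨x, rfl⟩ _ ⟨y, rfl⟩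
      exact ⟨x * y * x⁻¹ * y⁻¹, hc _ x.2 _ y.2, by simp⟩
    · rintro _ ⟨x, rfl⟩
      exact ⟨x * x, hs _ x.2, by simp⟩

theorem SectionBound.le_of_hasElementaryAbelianSection {n r : ℕ} (h : SectionBound G (2 ^ n))
    (hr : HasElementaryAbelianSection 2 G r) : r ≤ n := by
  obtain ⟨P, M, hM, ⟨e⟩⟩ := hr
  have key := h P (M.map P.subtype) (Subgroup.map_subtype_le M) ?_ ?_
  · rw [Subgroup.relIndex, Subgroup.subgroupOf,
      Subgroup.comap_map_eq_self_of_injective P.subtype_injective, Subgroup.index,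
      Nat.card_congr e.toEquiv] at key
    have hc : Nat.card (Multiplicative (Fin r → ZMod 2)) = 2 ^ r := by
      rw [Nat.card_congr Multiplicative.toAdd]; simp
    rw [hc] at key
    exact (Nat.pow_le_pow_iff_right (by norm_num)).1 key
  · intro x hx y hy
    refine ⟨⟨x, hx⟩ * ⟨y, hy⟩ * ⟨x, hx⟩⁻¹ * ⟨y, hy⟩⁻¹, ?_, rfl⟩
    rw [SetLike.mem_coe, ← QuotientGroup.eq_one_iff]
    apply e.injective
    simp only [QuotientGroup.mk_mul, QuotientGroup.mk_inv, map_mul, map_inv, map_one]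
    rw [mul_inv_cancel_comm, mul_inv_cancel]
  · intro x hx
    refine ⟨⟨x, hx⟩ * ⟨x, hx⟩, ?_, rfl⟩
    rw [SetLike.mem_coe, ← QuotientGroup.eq_one_iff]
    apply e.injective
    rw [QuotientGroup.mk_mul, map_mul, map_one]
    apply Multiplicative.toAdd.injective
    funext i
    exact CharTwo.add_self_eq_zero _

/-- In a finite commutative group, a section of exponent `2` is no larger than the `2`-torsion. -/
theorem SectionBound.of_comm [Finite G] (hcomm : ∀ x y : G, x * y = y * x) :
    SectionBound G (Nat.card {x : G // x * x = 1}) := by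
  let _ : CommGroup G := { (inferInstance : Group G) with mul_comm := hcomm }
  intro P M hMP _ hs
  let s : P →* P := powMonoidHom 2
  -- `M` contains all squares of `P`, and the subgroup of squares has index equal to the order of
  -- the kernel of squaring.
  have h1 : s.range ≤ M.subgroupOf P := by
    rintro _ ⟨x, rfl⟩
    simpa [s, sq, Subgroup.mem_subgroupOf] using hs x x.2
  have h2 : s.range.index = Nat.card s.ker := by
    have a := Subgroup.card_mul_index s.range
    have b := Subgroup.card_mul_index s.ker
    rw [Subgroup.index_ker] at b
    have : 0 < Nat.card s.range := Nat.card_pos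
    rw [← b, mul_comm] at a
    exact Nat.eq_of_mul_eq_mul_right this a
  calc M.relIndex P ≤ s.range.index := Subgroup.index_antitone h1
    _ = Nat.card s.ker := h2
    _ ≤ _ := by
      refine Nat.card_le_card_of_injective
        (fun x : s.ker => (⟨(x : P), ?_⟩ : {x : G // x * x = 1})) ?_
      · have := x.2
        rw [MonoidHom.mem_ker] at this
        simpa [s, sq] using congrArg Subtype.val this
      · intro x y hxy
        exact Subtype.ext (Subtype.ext (congrArg (fun z => z.1) hxy))

theorem SectionBound.of_card [Finite G] : SectionBound G (Nat.card G) := fun P M _ _ _ =>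
  (Nat.le_of_dvd Nat.card_pos (Subgroup.relIndex_dvd_card M P)).trans
    (Nat.le_of_dvd Nat.card_pos (Subgroup.card_subgroup_dvd_card P))

theorem SectionBound.mono {c d : ℕ} (h : SectionBound G c) (hcd : c ≤ d) : SectionBound G d :=
  fun P M h1 h2 h3 => (h P M h1 h2 h3).trans hcd

/-- A noncommutative group of order `2 ^ (n + 1)` has no elementary abelian section of that
order. -/
theorem SectionBound.of_noncomm {n : ℕ} (hG : Nat.card G = 2 ^ (n + 1)) {a b : G}
    (hab : a * b ≠ b * a) : SectionBound G (2 ^ n) := by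
  intro P M hMP hc _
  have : Finite G := Nat.finite_of_card_ne_zero (by rw [hG]; positivity)
  have hd : M.relIndex P ∣ 2 ^ (n + 1) :=
    hG ▸ (Subgroup.relIndex_dvd_card M P).trans (Subgroup.card_subgroup_dvd_card P)
  obtain ⟨k, hk, hk'⟩ := (Nat.dvd_prime_pow Nat.prime_two).1 hd
  rw [hk']
  refine Nat.pow_le_pow_right (by norm_num) ?_
  by_contra hlt
  -- Full order forces `M = 1` and `P = G`, so every commutator of `G` would be trivial.
  obtain rfl : k = n + 1 := by omega
  have hPM : Nat.card M * M.relIndex P = Nat.card P := by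
    have := Subgroup.card_mul_index (M.subgroupOf P)
    rwa [Nat.card_congr (Subgroup.subgroupOfEquivOfLe hMP).toEquiv] at this
  have hP : Nat.card P ≤ Nat.card G := Nat.le_of_dvd Nat.card_pos (Subgroup.card_subgroup_dvd_card P)
  have hM1 : 0 < Nat.card M := Nat.card_pos
  have hpos : 0 < 2 ^ (n + 1) := by positivity
  rw [hk', hG.symm] at hPM
  rw [hG] at hPM hP
  have hMc : Nat.card M = 1 := by nlinarith
  have hPt : P = ⊤ := Subgroup.eq_top_of_card_eq P (by rw [hG, ← hPM, hMc, one_mul])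
  rw [Subgroup.card_eq_one] at hMc
  subst hPt hMc
  have := hc a trivial b trivial
  rw [Subgroup.mem_bot, mul_inv_eq_one, mul_inv_eq_iff_eq_mul] at this
  exact hab this

/-- If one Sylow subgroup satisfies a section bound, so does every `2`-group embedding in `G`. -/
theorem SectionBound.of_sylow [Finite G] {c : ℕ} (U : Sylow 2 G) (hU : SectionBound U c)
    (hH : IsPGroup 2 H) (f : H →* G) (hf : Function.Injective f) : SectionBound H c := by
  have h1 : IsPGroup 2 f.range := hH.of_surjective f.rangeRestrict f.rangeRestrict_surjective
  obtain ⟨Q, hQ⟩ := h1.exists_le_sylow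
  have hQb : SectionBound Q c := hU.of_injective (Q.equiv U).toMonoidHom (Q.equiv U).injective
  exact hQb.of_injective (f.codRestrict (Q : Subgroup G) fun x => hQ ⟨x, rfl⟩)
    fun x y hxy => hf (congrArg Subtype.val hxy)

end SectionBound

/-! ### Finite 2-subgroups of `SL₂(E)` -/

section SL2

variable {E : Type*} [Field E]

/-- Only the matrices modulo scalars matter: the equations say that the vectors `(x₀₁, x₁₀, x₀₀ -
x₁₁)` and `(y₀₁, y₁₀, y₀₀ - y₁₁)` are proportional. -/
theorem SL2.mul_eq_mul_iff (x y : SL(2, E)) : x * y = y * x ↔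
    x 0 1 * y 1 0 = y 0 1 * x 1 0 ∧
    x 0 1 * (y 0 0 - y 1 1) = y 0 1 * (x 0 0 - x 1 1) ∧
    x 1 0 * (y 0 0 - y 1 1) = y 1 0 * (x 0 0 - x 1 1) := by
  rw [Matrix.SpecialLinearGroup.ext_iff]
  simp only [Matrix.SpecialLinearGroup.coe_mul, Matrix.mul_apply, Fin.sum_univ_two, Fin.forall_fin_two]
  constructor
  · rintro ⟨⟨h1, h2⟩, h3, h4⟩
    refine ⟨?_, ?_, ?_⟩
    · linear_combination h1
    · linear_combination -h2
    · linear_combination h3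
  · rintro ⟨h1, h2, h3⟩
    refine ⟨⟨?_, ?_⟩, ?_, ?_⟩
    · linear_combination h1
    · linear_combination -h2
    · linear_combination h3
    · linear_combination -h1

theorem SL2.eq_one_or_eq_neg_one {g : SL(2, E)} (h1 : g 0 1 = 0) (h2 : g 1 0 = 0)
    (h3 : g 0 0 = g 1 1) : g = 1 ∨ g = -1 := by
  have hd := Matrix.det_fin_two g.1
  rw [g.2, h1, h2, h3] at hd
  have : g 1 1 = 1 ∨ g 1 1 = -1 := by
    rw [← mul_self_eq_one_iff]
    linear_combination -hd
  refine this.imp (fun h => ?_) (fun h => ?_) <;>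
  · ext i j
    fin_cases i <;> fin_cases j <;> simp [h1, h2, h3, h]

/-- For nonscalar `g` the vector above is nonzero, and those of `a` and `b` are multiples of it. -/
theorem SL2.eq_one_or_eq_neg_one_or_commute {g a b : SL(2, E)} (ha : g * a = a * g)
    (hb : g * b = b * g) : (g = 1 ∨ g = -1) ∨ a * b = b * a := by
  by_cases hg : g 0 1 = 0 ∧ g 1 0 = 0 ∧ g 0 0 - g 1 1 = 0
  · exact Or.inl (SL2.eq_one_or_eq_neg_one hg.1 hg.2.1 (sub_eq_zero.1 hg.2.2))
  right
  rw [SL2.mul_eq_mul_iff] at *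
  obtain ⟨a1, a2, a3⟩ := ha
  obtain ⟨b1, b2, b3⟩ := hb
  generalize g 0 0 - g 1 1 = s, g 0 1 = p, g 1 0 = q at *
  generalize a 0 0 - a 1 1 = as, a 0 1 = ap, a 1 0 = aq at *
  generalize b 0 0 - b 1 1 = bs, b 0 1 = bp, b 1 0 = bq at *
  by_cases hp : p = 0
  · by_cases hq : q = 0
    · have hs : s ≠ 0 := fun h => hg ⟨hp, hq, h⟩
      subst hp hq
      have : ap = 0 := by simpa [hs] using a2.symm
      have : bp = 0 := by simpa [hs] using b2.symm
      have : aq = 0 := by simpa [hs] using a3.symm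
      have : bq = 0 := by simpa [hs] using b3.symm
      simp [*]
    · subst hp
      have : ap = 0 := by simpa [hq] using a1.symm
      have : bp = 0 := by simpa [hq] using b1.symm
      subst ap bp
      refine ⟨by simp, by simp, ?_⟩
      apply mul_left_cancel₀ hq
      linear_combination aq * b3 - bq * a3
  · refine ⟨?_, ?_, ?_⟩
    · apply mul_left_cancel₀ hp
      linear_combination ap * b1 - bp * a1
    · apply mul_left_cancel₀ hp
      linear_combination ap * b2 - bp * a2
    · apply mul_left_cancel₀ (mul_ne_zero hp hp)
      linear_combination p * bs * a1 + ap * q * b2 - (p * as * b1 + bp * q * a2)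

/-- By Cayley–Hamilton, `tr(x) x = x² + 1 = 2`; hence the trace is nonzero and `x` is scalar. -/
theorem SL2.eq_one_or_eq_neg_one_of_mul_self (h2 : (2 : E) ≠ 0) {x : SL(2, E)}
    (hx : x * x = 1) : x = 1 ∨ x = -1 := by
  have hd := Matrix.det_fin_two x.1
  rw [x.2] at hd
  rw [Matrix.SpecialLinearGroup.ext_iff] at hx
  simp only [Matrix.SpecialLinearGroup.coe_mul, Matrix.SpecialLinearGroup.coe_one, Matrix.mul_apply, Fin.sum_univ_two, Fin.forall_fin_two] at hx
  obtain ⟨⟨e1, e2⟩, e3, e4⟩ := hx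
  simp at e1 e2 e3 e4
  have ht : x 0 0 + x 1 1 ≠ 0 := by
    intro h
    apply h2
    linear_combination -e1 + x 0 0 * h + hd
  apply SL2.eq_one_or_eq_neg_one
  · apply mul_left_cancel₀ ht
    linear_combination e2
  · apply mul_left_cancel₀ ht
    linear_combination e3
  · apply mul_left_cancel₀ ht
    linear_combination e1 - e4

variable {R : Type*} [Group R]

theorem card_two_torsion_le (h2 : (2 : E) ≠ 0) (f : R →* SL(2, E)) (hf : Function.Injective f) :
    Nat.card {x : R // x * x = 1} ≤ 2 := by
  have := Nat.card_le_card_of_injective (fun x : {x : R // x * x = 1} => f x = 1) ?_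
  · simpa using this
  · intro x y hxy
    have key : ∀ z : {x : R // x * x = 1}, f z = 1 ∨ f z = -1 := fun z =>
      SL2.eq_one_or_eq_neg_one_of_mul_self h2 (by rw [← map_mul, z.2, map_one])
    refine Subtype.ext (hf ?_)
    have hxy : f x = 1 ↔ f y = 1 := iff_of_eq hxy
    grind

/-- A finite `2`-subgroup of `SL₂(E)` has a commutative normal subgroup of index at most `2`. -/
theorem exists_comm_index_dvd_two [Finite R] (hR : IsPGroup 2 R) (f : R →* SL(2, E))
    (hf : Function.Injective f) :
    ∃ A : Subgroup R, A.Normal ∧ A.index ∣ 2 ∧ ∀ x ∈ A, ∀ y ∈ A, x * y = y * x := by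
  by_cases hcomm : ∀ x y : R, x * y = y * x
  · exact ⟨⊤, inferInstance, by simp, fun x _ y _ => hcomm x y⟩
  push Not at hcomm
  obtain ⟨a, b, hab⟩ := hcomm
  -- Choose `g` noncentral in `R` but central modulo `Z(R)`; its centralizer will be the required
  -- subgroup.
  have hnt : Nontrivial (R ⧸ Subgroup.center R) := by
    rw [QuotientGroup.nontrivial_iff]
    intro h
    exact hab ((Subgroup.mem_center_iff.1 (h ▸ Subgroup.mem_top b) a))
  have hz := (hR.to_quotient (Subgroup.center R)).center_nontrivial
  obtain ⟨⟨g', hg'⟩, hne⟩ := exists_ne (1 : Subgroup.center (R ⧸ Subgroup.center R))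
  obtain ⟨g, rfl⟩ := QuotientGroup.mk_surjective g'
  have hg : g ∉ Subgroup.center R := fun h =>
    hne (Subtype.ext ((QuotientGroup.eq_one_iff g).2 h))
  -- The commutator of `g` and `r` is central, so it commutes with the noncommuting pair `a`, `b`
  -- and must be `±1`.
  have hcom : ∀ r : R, f (g * r) = f (r * g) ∨ f (g * r) = -f (r * g) := by
    intro r
    have h1 : g * r * (r * g)⁻¹ ∈ Subgroup.center R := by
      rw [← QuotientGroup.eq_one_iff, QuotientGroup.mk_mul, QuotientGroup.mk_inv, mul_inv_eq_one]
      exact (Subgroup.mem_center_iff.1 hg' r).symm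
    have h2 : ∀ s, f (g * r * (r * g)⁻¹) * f s = f s * f (g * r * (r * g)⁻¹) := fun s => by
      rw [← map_mul, ← map_mul, Subgroup.mem_center_iff.1 h1 s]
    rcases SL2.eq_one_or_eq_neg_one_or_commute (h2 a) (h2 b) with h | h
    · rw [map_mul, map_inv] at h
      rw [mul_inv_eq_one, mul_inv_eq_iff_eq_mul, neg_one_mul] at h
      exact h
    · rw [← map_mul, ← map_mul] at h
      exact absurd (hf h) hab
  have hidx : (Subgroup.centralizer {g}).index ∣ 2 := by
    rw [Subgroup.index_dvd_two_iff]
    have : ∃ c, c ∉ Subgroup.centralizer {g} := by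
      by_contra! h
      apply hg
      rw [Subgroup.mem_center_iff]
      intro c
      exact ((Subgroup.mem_centralizer_singleton_iff).1 (h c))
    obtain ⟨c, hc⟩ := this
    -- Two elements that anticommute with `g` have a product that commutes with it.
    refine ⟨c, fun b => or_iff_not_imp_right.2 fun hb => ?_⟩
    rw [Subgroup.mem_centralizer_singleton_iff] at hb hc ⊢
    have hb' := (hcom b).resolve_left fun h => hb (hf h).symm
    have hc' := (hcom c).resolve_left fun h => hc (hf h).symm
    apply hf
    simp only [map_mul] at *
    rw [← mul_assoc (f g), hb', neg_mul, mul_assoc (f b) (f g), hc', mul_neg, neg_neg, mul_assoc]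
  refine ⟨Subgroup.centralizer {g}, ?_, hidx, ?_⟩
  · rcases (Nat.dvd_prime Nat.prime_two).1 hidx with h | h
    · rw [Subgroup.index_eq_one.1 h]; infer_instance
    · exact Subgroup.normal_of_index_eq_two h
  · intro x hx y hy
    rw [Subgroup.mem_centralizer_singleton_iff] at hx hy
    have h2 : ∀ s, s * g = g * s → f g * f s = f s * f g := fun s hs => by
      rw [← map_mul, ← map_mul, hs]
    rcases SL2.eq_one_or_eq_neg_one_or_commute (h2 x hx) (h2 y hy) with h | h
    · refine absurd (Subgroup.mem_center_iff.2 fun s => hf ?_) hg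
      rcases h with h | h <;> simp [h]
    · rw [← map_mul, ← map_mul] at h
      exact hf h

end SL2

/-! ### Wreath products on three coordinates and their Sylow 2-subgroups -/

section Wreath

/-- A Sylow `2`-subgroup of `S₃`. -/
abbrev swapGroup : Subgroup (Equiv.Perm (Fin 3)) := Subgroup.zpowers (Equiv.swap 0 1)

theorem card_swapGroup : Nat.card swapGroup = 2 := by
  rw [Nat.card_zpowers]
  exact orderOf_eq_prime (by decide) (by decide)

/-- The wreath product `G ≀ ⟨(0 1)⟩` acting on three coordinates. -/
abbrev SwapWreath (G : Type*) [Group G] : Type _ := (Fin 3 → G) ⋊[mulAutArrow] swapGroup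

variable {G H : Type*} [Group G] [Group H]

/-- The homomorphism of wreath products induced by a homomorphism of the base. -/
def SwapWreath.map (f : G →* H) : SwapWreath G →* SwapWreath H :=
  SemidirectProduct.map (MonoidHom.pi fun i => f.comp (Pi.evalMonoidHom _ i)) (MonoidHom.id _)
    fun _ => rfl

/-- The embedding of `G ≀ ⟨(0 1)⟩` in `H ≀ S₃` induced by a homomorphism `G →* H`. -/
def SwapWreath.toPerm (f : G →* H) :
    SwapWreath G →* (Fin 3 → H) ⋊[mulAutArrow] Equiv.Perm (Fin 3) :=
  SemidirectProduct.map (MonoidHom.pi fun i => f.comp (Pi.evalMonoidHom _ i)) swapGroup.subtype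
    fun _ => rfl

theorem SwapWreath.toPerm_injective {f : G →* H} (hf : Function.Injective f) :
    Function.Injective (SwapWreath.toPerm f) := by
  intro x y hxy
  refine SemidirectProduct.ext ?_ ?_
  · funext i
    exact hf (congrFun (congrArg SemidirectProduct.left hxy) i)
  · exact Subtype.ext (congrArg SemidirectProduct.right hxy)

theorem SwapWreath.card : Nat.card (SwapWreath G) = Nat.card G ^ 3 * 2 := by
  rw [SemidirectProduct.card, card_swapGroup, Nat.card_fun, Nat.card_fin]

instance [Finite G] : Finite (SwapWreath G) :=
  Finite.of_equiv _ SemidirectProduct.equivProd.symm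

instance [Finite G] : Finite ((Fin 3 → G) ⋊[mulAutArrow] Equiv.Perm (Fin 3)) :=
  Finite.of_equiv _ SemidirectProduct.equivProd.symm

/-- If `G` has order at most `2` then `G ≀ ⟨(0 1)⟩` has sectional `2`-rank at most `3`. -/
theorem SwapWreath.sectionBound_eight (hG : Nat.card G ∣ 2) : SectionBound (SwapWreath G) 8 := by
  have : Finite G := Nat.finite_of_card_ne_zero (ne_zero_of_dvd_ne_zero two_ne_zero hG)
  rcases (Nat.dvd_prime Nat.prime_two).1 hG with h | h
  · exact SectionBound.of_card.mono (by rw [SwapWreath.card, h]; norm_num)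
  · have hn : Nontrivial G := Finite.one_lt_card_iff_nontrivial.1 (by omega)
    obtain ⟨g, hg⟩ := exists_ne (1 : G)
    let s : swapGroup := ⟨_, Subgroup.mem_zpowers _⟩
    -- The order is `2³ · 2 = 2⁴`, and the swap moves an element supported at coordinate 0.
    refine SectionBound.of_noncomm (n := 3) (by rw [SwapWreath.card, h]; norm_num)
      (a := SemidirectProduct.inl (Pi.mulSingle 0 g)) (b := SemidirectProduct.inr s) ?_
    intro h
    have h1 := congrFun (congrArg SemidirectProduct.left h) 0
    have h2 : (mulAutArrow s (Pi.mulSingle 0 g) : Fin 3 → G) 0 =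
        (Pi.mulSingle 0 g : Fin 3 → G) (s⁻¹ • (0 : Fin 3)) := rfl
    have h3 : s⁻¹ • (0 : Fin 3) = 1 := by
      change (Equiv.swap (0 : Fin 3) 1)⁻¹ 0 = 1
      decide
    rw [h3, Pi.mulSingle_eq_of_ne (by decide)] at h2
    apply hg
    simpa [h2] using h1

/-- If `R` has a commutative normal subgroup of index at most `2` and at most one involution, then
`R ≀ ⟨(0 1)⟩` has sectional `2`-rank at most `6`. -/
theorem SwapWreath.sectionBound [Finite G] (A : Subgroup G) [A.Normal] (hA : A.index ∣ 2)
    (hc : ∀ x ∈ A, ∀ y ∈ A, x * y = y * x) (ht : Nat.card {x : G // x * x = 1} ≤ 2) :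
    SectionBound (SwapWreath G) (2 ^ 6) := by
  -- The kernel of this map onto `(G/A) ≀ C₂` is `A³`, where at most `2³` elements square to 1.
  let f := SwapWreath.map (QuotientGroup.mk' A)
  have hright : ∀ x : f.ker, x.1.right = 1 := fun x => congrArg SemidirectProduct.right x.2
  have hleft : ∀ (x : f.ker) i, x.1.left i ∈ A := fun x i =>
    (QuotientGroup.eq_one_iff _).1 (congrFun (congrArg SemidirectProduct.left x.2) i)
  have hmul : ∀ (x y : f.ker) i, (x * y).1.left i = x.1.left i * y.1.left i := fun x y i => by
    have : (x * y).1 = x.1 * y.1 := rfl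
    rw [this, SemidirectProduct.mul_left, hright x, map_one]
    rfl
  have hker : SectionBound f.ker (2 ^ 3) := by
    refine (SectionBound.of_comm fun x y => ?_).mono ?_
    · refine Subtype.ext (SemidirectProduct.ext ?_ ?_)
      · funext i
        rw [hmul, hmul, hc _ (hleft x i) _ (hleft y i)]
      · rw [hright, hright]
    · calc _ ≤ Nat.card (Fin 3 → {x : G // x * x = 1}) := by
            refine Nat.card_le_card_of_injective (fun x i => ⟨x.1.1.left i, ?_⟩) ?_
            · rw [← hmul, x.2]; rfl
            · intro x y hxy
              refine Subtype.ext (Subtype.ext (SemidirectProduct.ext ?_ ?_))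
              · funext i
                exact congrArg Subtype.val (congrFun hxy i)
              · rw [hright, hright]
        _ ≤ 2 ^ 3 := by
            rw [Nat.card_fun, Nat.card_fin]
            exact Nat.pow_le_pow_left ht 3
  exact (SectionBound.of_ker f hker (SwapWreath.sectionBound_eight hA)).mono (by norm_num)

/-- For a Sylow `2`-subgroup `R` of `G`, the group `R ≀ ⟨(0 1)⟩` is a Sylow `2`-subgroup of
`G ≀ S₃`. -/
theorem SwapWreath.exists_sylow [Finite G] (R : Sylow 2 G) :
    ∃ U : Sylow 2 ((Fin 3 → G) ⋊[mulAutArrow] Equiv.Perm (Fin 3)),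
      Nonempty (U ≃* SwapWreath R) := by
  have hinj := SwapWreath.toPerm_injective (R : Subgroup G).subtype_injective
  let e := MonoidHom.ofInjective hinj
  refine ⟨Sylow.ofCard (SwapWreath.toPerm (R : Subgroup G).subtype).range ?_, ⟨e.symm⟩⟩
  rw [← Nat.card_congr e.toEquiv, SwapWreath.card, SemidirectProduct.card, Nat.card_fun,
    Nat.card_fin, Sylow.card_eq_multiplicity R, Nat.card_perm, Nat.card_fin]
  have h0 : Nat.card G ≠ 0 := Nat.card_pos.ne'
  rw [Nat.factorization_mul (pow_ne_zero _ h0) (by decide), Nat.factorization_pow]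
  -- The 2-part of `|S₃|` is the order of `⟨(0 1)⟩`.
  have h6 : (Nat.factorial 3).factorization 2 = 1 := by
    rw [show Nat.factorial 3 = 2 ^ 1 * 3 by decide]
    rw [Nat.factorization_mul (by norm_num) (by norm_num), Nat.factorization_pow]
    simp [Nat.prime_two.factorization, Nat.prime_three.factorization]
  simp only [Finsupp.coe_add, Finsupp.coe_smul, Pi.add_apply, Pi.smul_apply, smul_eq_mul, h6]
  ring

theorem sectionBound_of_wreath [Finite G] {E : Type*} [Field E] (h2 : (2 : E) ≠ 0)
    (f : G →* SL(2, E)) (hf : Function.Injective f) (hH : IsPGroup 2 H)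
    (g : H →* (Fin 3 → G) ⋊[mulAutArrow] Equiv.Perm (Fin 3)) (hg : Function.Injective g) :
    SectionBound H (2 ^ 6) := by
  obtain ⟨R⟩ : Nonempty (Sylow 2 G) := inferInstance
  have hR := hf.comp (R : Subgroup G).subtype_injective
  obtain ⟨A, hA, hi, hc⟩ := exists_comm_index_dvd_two R.2 (f.comp (R : Subgroup G).subtype) hR
  obtain ⟨U, ⟨e⟩⟩ := SwapWreath.exists_sylow R
  have ht := card_two_torsion_le h2 (f.comp (R : Subgroup G).subtype) hR
  exact SectionBound.of_sylow U
    ((SwapWreath.sectionBound A hi hc ht).of_injective e.toMonoidHom e.injective) hH g hg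

end Wreath

/-! ### `SL₂(F)³` lies in `O²(N₀)` -/

section Residual

variable {F : Type*} [Field F]

open Matrix.SpecialLinearGroup in
-- A matrix with nonzero lower left entry is a product upper·lower·upper of transvections; otherwise
-- one lower transvection makes that entry nonzero.
theorem SL2.eq_top_of_transvection_mem (M : Subgroup SL(2, F))
    (h : ∀ (i j : Fin 2) (hij : i ≠ j) (b : F), transvection hij b ∈ M) : M = ⊤ := by
  have key : ∀ g : SL(2, F), g 1 0 ≠ 0 → g ∈ M := by
    intro g hg
    have : g = transvection zero_ne_one ((g 0 0 - 1) / g 1 0) * transvection one_ne_zero (g 1 0) *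
        transvection zero_ne_one ((g 1 1 - 1) / g 1 0) := by
      have hd := Matrix.det_fin_two g.1
      rw [g.2] at hd
      ext i j
      fin_cases i <;> fin_cases j <;>
        simp [transvection_coe, Matrix.mul_apply, Fin.sum_univ_two, Matrix.single] <;>
        field_simp
      · ring
      · linear_combination hd
      · ring
    rw [this]
    exact mul_mem (mul_mem (h _ _ _ _) (h _ _ _ _)) (h _ _ _ _)
  refine eq_top_iff.2 fun g _ => ?_
  by_cases hg : g 1 0 = 0
  · refine (Subgroup.mul_mem_cancel_left M (h 1 0 one_ne_zero 1)).1 (key _ ?_)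
    have hd := Matrix.det_fin_two g.1
    rw [g.2, hg] at hd
    intro h0
    simp [transvection_coe, Matrix.mul_apply, Fin.sum_univ_two, Matrix.single, hg] at h0
    simp [h0] at hd
  · exact key g hg

open Matrix.SpecialLinearGroup in
/-- Over a finite field of odd order, `SL₂` has no proper subgroup containing all `2 ^ k`-th
powers. -/
theorem SL2.eq_top_of_pow_mem (hF : Odd (Nat.card F)) (M : Subgroup SL(2, F)) (k : ℕ)
    (h : ∀ x : SL(2, F), x ^ 2 ^ k ∈ M) : M = ⊤ := by
  refine SL2.eq_top_of_transvection_mem M fun i j hij b => ?_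
  have hpow : ∀ n : ℕ, transvection hij b ^ n = transvection hij (n * b) := by
    intro n
    induction n with
    | zero => simp
    | succ n ih => rw [pow_succ, ih, ← transvection_add]; congr 1; push_cast; ring
  -- Transvections have odd order, so each is a power of its own `2 ^ k`-th power.
  have h1 : transvection hij b ^ Nat.card F = 1 := by
    have : Finite F := Nat.finite_of_card_ne_zero fun h0 => by simp [h0] at hF
    have := Fintype.ofFinite F
    rw [hpow, Nat.card_eq_fintype_card, Nat.cast_card_eq_zero, zero_mul, transvection_coeff_zero]
  have h2 : (2 ^ k).Coprime (orderOf (transvection hij b)) :=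
    Nat.Coprime.coprime_dvd_right (orderOf_dvd_of_pow_eq_one h1)
      (Nat.Coprime.pow_left k (Nat.coprime_two_left.2 hF))
  obtain ⟨m, hm⟩ := exists_pow_eq_self_of_coprime h2
  rw [← hm]
  exact pow_mem (h _) m

variable (F) (E : Type*) [Field E] [Algebra F E]

/-- The inclusion of `SL₂(F)` in its normalizer in `SL₂(E)`. -/
def toN : SL(2, F) →* N F E :=
  (Matrix.SpecialLinearGroup.map (n := Fin 2) (algebraMap F E)).codRestrict _
    fun x => Subgroup.le_normalizer (H := SL2sub F E) ⟨x, rfl⟩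

theorem toN_injective : Function.Injective (toN F E) := by
  intro x y hxy
  have h := congrArg Subtype.val hxy
  ext i j
  exact (algebraMap F E).injective (congrArg (fun z : SL(2, E) => z i j) h)

/-- The inclusion of `SL₂(F)³` in `W`. -/
def cubeToW : (Fin 3 → SL(2, F)) →* W F E :=
  SemidirectProduct.inl.comp (MonoidHom.pi fun i => (toN F E).comp (Pi.evalMonoidHom _ i))

/-- A normal subgroup of index `2 ^ k` contains all `2 ^ k`-th powers, hence each coordinate copy of
`SL₂(F)`. -/
theorem cubeToW_mem_baseResidual (hF : Odd (Nat.card F)) (x : Fin 3 → SL(2, F)) :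
    cubeToW F E x ∈ baseResidual F E := by
  let c : (Fin 3 → SL(2, F)) →* base F E :=
    (cubeToW F E).codRestrict (base F E) fun x => ⟨_, rfl⟩
  refine ⟨c x, ?_, rfl⟩
  rw [SetLike.mem_coe, pResidual, Subgroup.mem_sInf]
  rintro M ⟨hM, k, hk⟩
  change x ∈ M.comap c
  refine Subgroup.pi_mem_of_mulSingle_mem x fun i => ?_
  have hM : (M.comap (c.comp (MonoidHom.mulSingle _ i))) = ⊤ :=
    SL2.eq_top_of_pow_mem hF _ k fun y => by
      rw [Subgroup.mem_comap, map_pow, ← hk]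
      exact M.pow_index_mem _
  have hx : x i ∈ M.comap (c.comp (MonoidHom.mulSingle _ i)) := hM ▸ Subgroup.mem_top (x i)
  exact hx

end Residual

/-! ### The quaternion group and its elementary abelian quotient -/

section Quaternion

/-- The homomorphism from the quaternion group of order `8` given by elements satisfying its
defining relations. -/
def quaternionLift {G : Type*} [Group G] (u v : G) (hu : u ^ 4 = 1) (hv : v * v = u ^ 2)
    (huv : u * v = v * u⁻¹) : QuaternionGroup 2 →* G :=
  let p : ZMod 4 →+ Additive G := ZMod.lift 4
    ⟨zmultiplesHom (Additive G) (Additive.ofMul u), by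
      have : (4 : ℤ) • Additive.ofMul u = 0 := by
        rw [← ofMul_zpow, ofMul_eq_zero]
        exact_mod_cast hu
      simpa using! this⟩
  have hp : ∀ k : ℤ, (p k).toMul = u ^ k := fun k => by
    simp [p, ZMod.lift_coe, ← ofMul_zpow]
  have hpv : ∀ i : ZMod 4, (p i).toMul * v = v * (p i).toMul⁻¹ := fun i => by
    obtain ⟨k, rfl⟩ := ZMod.intCast_surjective i
    rw [hp, ← inv_zpow]
    have hs : SemiconjBy v u⁻¹ u := huv.symm
    exact (hs.zpow_right k).eq.symm
  have hp2 : (p 2).toMul = v * v := by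
    have := hp 2
    rw [hv]
    exact_mod_cast this
  { toFun := fun x => match x with
      | .a i => (p i).toMul
      | .xa i => v * (p i).toMul
    map_one' := by
      change (p 0).toMul = 1
      simp
    map_mul' := by
      rintro (i | i) (j | j)
      · change (p (i + j)).toMul = _
        simp
      · change v * (p (j - i)).toMul = (p i).toMul * (v * (p j).toMul)
        rw [← mul_assoc, hpv, sub_eq_neg_add, map_add, map_neg]
        simp [mul_assoc]
      · change v * (p (i + j)).toMul = _
        simp [mul_assoc]
      · change (p (2 + j - i)).toMul = v * (p i).toMul * (v * (p j).toMul)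
        rw [mul_assoc, ← mul_assoc _ v, hpv, add_sub_assoc, sub_eq_neg_add, map_add,
          toMul_add, map_add p (-i), map_neg, hp2]
        simp [mul_assoc] }

theorem quaternionLift_a_two {G : Type*} [Group G] (u v : G) (hu : u ^ 4 = 1) (hv : v * v = u ^ 2)
    (huv : u * v = v * u⁻¹) : quaternionLift u v hu hv huv (.a 2) = u ^ 2 := by
  have h : quaternionLift u v hu hv huv (.xa 0) = v := by
    change v * Additive.toMul ((ZMod.lift 4 _ : ZMod 4 →+ Additive G) 0) = v
    rw [map_zero, toMul_zero, mul_one]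
  calc _ = quaternionLift u v hu hv huv (.xa 0 * .xa 0) := rfl
    _ = u ^ 2 := by rw [map_mul, h, hv]

/-- The quotient of the quaternion group of order `8` by its centre. -/
def quaternionAb : QuaternionGroup 2 →* Multiplicative (Fin 2 → ZMod 2) where
  toFun := fun x => match x with
    | .a i => Multiplicative.ofAdd ![(ZMod.castHom (show 2 ∣ 4 by decide) (ZMod 2)) i, 0]
    | .xa i => Multiplicative.ofAdd ![(ZMod.castHom (show 2 ∣ 4 by decide) (ZMod 2)) i, 1]
  map_one' := by decide
  map_mul' := by decide

theorem quaternionAb_surjective : Function.Surjective quaternionAb := by decide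

/-- Under a homomorphism that does not kill `.a 2`, the images of such `x` and `y` do not commute.
-/
theorem exists_mul_eq_of_quaternionAb_ne_one :
    ∀ x : QuaternionGroup 2, quaternionAb x ≠ 1 → ∃ y, x * y = .a 2 * (y * x) := by decide

/-- A finite field contains a quaternion group of order `8` in `SL₂`. -/
theorem SL2.exists_quaternion {F : Type*} [Field F] [Finite F] (h2 : (2 : F) ≠ 0) :
    ∃ f : QuaternionGroup 2 →* SL(2, F), f (.a 2) ≠ 1 := by
  obtain ⟨p, hp⟩ := CharP.exists F
  have : NeZero p := ⟨fun h => by subst h; exact (CharP.char_ne_zero_of_finite F 0) rfl⟩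
  -- With `a² + b² = -1`, the traceless matrices `u` and `v` below have determinant 1, so both
  -- square to `-1`; they also anticommute.
  obtain ⟨a, b, hab⟩ := CharP.sq_add_sq F p (-1)
  push_cast at hab
  obtain ⟨u, hu⟩ : ∃ u : SL(2, F), u.1 = !![0, 1; -1, 0] :=
    ⟨⟨_, by simp [Matrix.det_fin_two]⟩, rfl⟩
  obtain ⟨v, hv⟩ : ∃ v : SL(2, F), v.1 = !![(a : F), b; b, -a] :=
    ⟨⟨_, by
      rw [Matrix.det_fin_two]
      simp only [Matrix.of_apply, Matrix.cons_val]
      linear_combination -hab⟩, rfl⟩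
  have hu2 : u ^ 2 = -1 := by
    ext i j
    fin_cases i <;> fin_cases j <;> simp [hu, pow_two]
  have hv2 : v * v = -1 := by
    ext i j
    fin_cases i <;> fin_cases j <;> simp [hv]
    · linear_combination hab
    · ring
    · ring
    · linear_combination hab
  have huv : u * v = v * u⁻¹ := by
    ext i j
    fin_cases i <;> fin_cases j <;> simp [hu, hv, Matrix.adjugate_fin_two]
  refine ⟨quaternionLift u v ?_ (hv2.trans hu2.symm) huv, ?_⟩
  · rw [show 4 = 2 * 2 from rfl, pow_mul, hu2]; simp
  · rw [quaternionLift_a_two, hu2]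
    intro h
    have h1 := congrArg (fun z : SL(2, F) => z 0 0) h
    simp at h1
    apply h2
    linear_combination -h1

end Quaternion

/-- The map `π` factors through the range of `φ`, which serves as `P`. -/
theorem hasElementaryAbelianSection_of_hom {p r : ℕ} {Q G : Type*} [Group Q] [Group G]
    (φ : Q →* G) (π : Q →* Multiplicative (Fin r → ZMod p)) (hπ : Function.Surjective π)
    (h : φ.ker ≤ π.ker) : HasElementaryAbelianSection p G r := by
  let ψ : φ.range →* Multiplicative (Fin r → ZMod p) :=
    (QuotientGroup.lift φ.ker π h).comp (QuotientGroup.quotientKerEquivRange φ).symm.toMonoidHom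
  have hψ : Function.Surjective ψ :=
    (QuotientGroup.lift_surjective_of_surjective φ.ker π hπ h).comp
      (QuotientGroup.quotientKerEquivRange φ).symm.surjective
  exact ⟨φ.range, ψ.ker, inferInstance, ⟨QuotientGroup.quotientKerEquivOfSurjective ψ hψ⟩⟩

/-- The quotient of the cube of the quaternion group of order `8` by its centre. -/
def quaternionCubeAb : (Fin 3 → QuaternionGroup 2) →* Multiplicative (Fin 6 → ZMod 2) where
  toFun x := Multiplicative.ofAdd fun k : Fin (3 * 2) =>
    (quaternionAb (x (finProdFinEquiv.symm k).1)).toAdd (finProdFinEquiv.symm k).2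
  map_one' := by simp; rfl
  map_mul' x y := by simp; rfl

theorem quaternionCubeAb_surjective : Function.Surjective quaternionCubeAb := by
  intro y
  choose g hg using quaternionAb_surjective
  refine ⟨fun i => g (Multiplicative.ofAdd fun j => y.toAdd (finProdFinEquiv (i, j))), ?_⟩
  apply Multiplicative.toAdd.injective
  funext k
  change (quaternionAb (g _)).toAdd _ = _
  rw [hg]
  exact congrArg y.toAdd ((finProdFinEquiv (m := 3) (n := 2)).apply_symm_apply k)

theorem quaternionCubeAb_eq_one {x : Fin 3 → QuaternionGroup 2} (h : ∀ i, quaternionAb (x i) = 1) :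
    quaternionCubeAb x = 1 := by
  apply Multiplicative.toAdd.injective
  funext k
  change (quaternionAb (x _)).toAdd _ = _
  rw [h]
  rfl

/-! ### The two bounds for a Sylow 2-subgroup of `K` -/

section Main

variable (F E : Type*) [Field F] [Field E] [Algebra F E]

theorem two_ne_zero_of_odd_card (hF : Odd (Nat.card F)) : (2 : F) ≠ 0 := by
  intro h
  have : Finite F := Nat.finite_of_card_ne_zero fun h0 => by simp [h0] at hF
  have := Fintype.ofFinite F
  have h1 := Nat.cast_card_eq_zero F
  obtain ⟨k, hk⟩ := hF
  rw [← Nat.card_eq_fintype_card, hk] at h1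
  push_cast at h1
  simp [h] at h1

theorem sectionBound_sylow [Finite E] (h2 : (2 : E) ≠ 0) (S : Sylow 2 (K F E)) :
    SectionBound S (2 ^ 6) := by
  obtain ⟨T, rfl⟩ := Sylow.mapSurjective_surjective
    (QuotientGroup.mk'_surjective (Subgroup.center (Khat F E))) 2 S
  have hT : SectionBound T (2 ^ 6) :=
    sectionBound_of_wreath h2 (N F E).subtype (N F E).subtype_injective T.2
      ((Khat F E).subtype.comp (T : Subgroup (Khat F E)).subtype)
      ((Khat F E).subtype_injective.comp (T : Subgroup (Khat F E)).subtype_injective)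
  let m := (QuotientGroup.mk' (Subgroup.center (Khat F E))).subgroupMap (T : Subgroup (Khat F E))
  exact hT.of_surjective m (MonoidHom.subgroupMap_surjective _ _)

theorem hasElementaryAbelianSection_sylow [Finite E] (hF : Odd (Nat.card F))
    (S : Sylow 2 (K F E)) : HasElementaryAbelianSection 2 S 6 := by
  have : Finite F := Nat.finite_of_card_ne_zero fun h0 => by simp [h0] at hF
  obtain ⟨f, hf⟩ := SL2.exists_quaternion (two_ne_zero_of_odd_card F hF)
  let c : (Fin 3 → QuaternionGroup 2) →* Khat F E :=
    ((cubeToW F E).comp (MonoidHom.pi fun i => f.comp (Pi.evalMonoidHom _ i))).codRestrict _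
      fun x => Subgroup.mem_sup_left (Subgroup.mem_sup_left (cubeToW_mem_baseResidual F E hF _))
  let φ := (QuotientGroup.mk' (Subgroup.center (Khat F E))).comp c
  have hQ : IsPGroup 2 (Fin 3 → QuaternionGroup 2) := IsPGroup.of_card (n := 9) (by
    rw [Nat.card_fun, Nat.card_eq_fintype_card (α := QuaternionGroup 2), QuaternionGroup.card]
    simp)
  obtain ⟨T, hT⟩ := (hQ.of_surjective φ.rangeRestrict φ.rangeRestrict_surjective).exists_le_sylow
  let ψ : (Fin 3 → QuaternionGroup 2) →* S :=
    (T.equiv S).toMonoidHom.comp (φ.codRestrict (T : Subgroup (K F E)) fun x => hT ⟨x, rfl⟩)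
  refine hasElementaryAbelianSection_of_hom ψ quaternionCubeAb quaternionCubeAb_surjective ?_
  intro x hx
  have hφ : φ x = 1 := congrArg Subtype.val ((T.equiv S).injective (hx.trans (map_one _).symm))
  have hc : c x ∈ Subgroup.center (Khat F E) := (QuotientGroup.eq_one_iff _).1 hφ
  refine quaternionCubeAb_eq_one fun i => ?_
  by_contra hi
  obtain ⟨y, hy⟩ := exists_mul_eq_of_quaternionAb_ne_one _ hi
  -- Only coordinate `i` is compared, so the constant tuple is a sufficient test element.
  have h1 := Subgroup.mem_center_iff.1 hc (c fun _ => y)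
  rw [← map_mul, ← map_mul] at h1
  have h2 : f (y * x i) = f (x i * y) := toN_injective F E
    (congrFun (congrArg (fun z => SemidirectProduct.left (Subtype.val z)) h1) i)
  rw [hy, map_mul (f := f) (.a 2), eq_comm, mul_eq_right] at h2
  exact hf h2

end Main

end BensonSolomon

theorem lemma2p6 (q : ℕ) (hq : Odd q) (F E : Type*) [Field F] [Finite F] [Field E] [Algebra F E]
    (hF : Nat.card F = q) (hE : Module.finrank F E = 2)
    (S : Sylow 2 (BensonSolomon.K F E)) :
    BensonSolomon.IsSectionalRank 2 S 6 := by
  have : Module.Finite F E := Module.finite_of_finrank_pos (by omega)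
  have : Finite E := Module.finite_of_finite F
  subst hF
  have h2 : (2 : E) ≠ 0 := by
    have := BensonSolomon.two_ne_zero_of_odd_card F hq
    rw [← map_ofNat (algebraMap F E) 2]
    exact (map_ne_zero _).2 this
  exact ⟨BensonSolomon.hasElementaryAbelianSection_sylow F E hq S, fun r hr =>
    (BensonSolomon.sectionBound_sylow F E h2 S).le_of_hasElementaryAbelianSection hr⟩
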